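/- Let $\mathcal A$ be a unital $C^*$-algebra, let $\mathbb M_n$ be the algebra of $n\times n$ complex matrices with the Loewner order, and let $\Phi:\mathcal A\to\mathbb M_n$ be a positive linear map that is sub-unital, i.e. $\Phi(I)\le I$ (in particular, $\Phi$ may be unital). Let $A\in\mathcal A$ with $A\ge 0$, and let $p,q,r\ge 0$ be real numbers such that $\min\{p,r\}\le q/2$ and $\max\{p,r\}\le q$. Then there is a unitary matrix $V\in\mathbb M_n$ such that $$|\Phi(A^p)\,\Phi(A^q)\,\Phi(A^r)|\le V\,\Phi(A^{p+q+r})\,V^*,$$ where $|Z|=(Z^*Z)^{1/2}$ and powers are defined by the continuous functional calculus, with $A^0=I$. -/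

import Mathlib

open scoped MatrixOrder

open Matrix Finset

/-! It suffices to compare eigenvalues in decreasing order (`exists_unitary_le`). Let `ν` exceed the
`i`-th eigenvalue of `Φ(A^(p+q+r))`. Jensen's inequality, at vectors orthogonal to the preceding
eigenvectors, bounds the `i`-th eigenvalue of `B = Φ(A^q)` by `β = ν^(1/(x+1+y))`, where `p = xq`,
`r = yq`. Restrict to `u` with `Φ(A^r) u` in the `B`-invariant subspace `S` orthogonal to the
preceding eigenvectors of `B`. The three factors then stretch by at most `β^y`, `β`, `β^x`: the
first two by `hermForm_one_mulVec_le`, since their outputs stay in `S`, and the last by Kadison's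
inequality, which needs `2x ≤ 1`. So `|Z| ≤ ν` as a form on these `u`, and min-max concludes. If
instead `r ≤ q/2`, pass to the adjoint. -/

section HermForm

/-! ### Quadratic forms of complex matrices. -/

open scoped ComplexOrder

variable {ι : Type*} [Fintype ι]

/-- The real part of the quadratic form `u ↦ ⟨u, H u⟩`. -/
noncomputable def hermForm (H : Matrix ι ι ℂ) (u : ι → ℂ) : ℝ := (star u ⬝ᵥ H *ᵥ u).re

theorem hermForm_add (H K : Matrix ι ι ℂ) (u : ι → ℂ) :
    hermForm (H + K) u = hermForm H u + hermForm K u := by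
  simp [hermForm, add_mulVec, dotProduct_add]

theorem hermForm_sub (H K : Matrix ι ι ℂ) (u : ι → ℂ) :
    hermForm (H - K) u = hermForm H u - hermForm K u := by
  simp [hermForm, sub_mulVec, dotProduct_sub]

theorem hermForm_smul (c : ℝ) (H : Matrix ι ι ℂ) (u : ι → ℂ) :
    hermForm (c • H) u = c * hermForm H u := by
  simp [hermForm, smul_mulVec, dotProduct_smul]

theorem hermForm_mulVec (H W : Matrix ι ι ℂ) (u : ι → ℂ) :
    hermForm H (W *ᵥ u) = hermForm (Wᴴ * H * W) u := by
  simp only [hermForm, star_mulVec, ← dotProduct_mulVec, mulVec_mulVec, Matrix.mul_assoc]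

theorem hermForm_mono {H K : Matrix ι ι ℂ} (h : H ≤ K) (u : ι → ℂ) :
    hermForm H u ≤ hermForm K u := by
  have := (Matrix.le_iff.1 h).dotProduct_mulVec_nonneg u
  have h2 : 0 ≤ hermForm (K - H) u := (Complex.le_def.1 this).1
  rw [hermForm_sub] at h2
  linarith

theorem hermForm_nonneg {H : Matrix ι ι ℂ} (h : 0 ≤ H) (u : ι → ℂ) : 0 ≤ hermForm H u := by
  simpa [hermForm] using hermForm_mono h u

variable [DecidableEq ι]

theorem hermForm_one (u : ι → ℂ) : hermForm 1 u = ∑ k, ‖u k‖ ^ 2 := by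
  simp only [hermForm, one_mulVec, dotProduct, Complex.re_sum]
  refine sum_congr rfl fun k _ => ?_
  simp [← Complex.normSq_eq_norm_sq, Complex.normSq_apply]

theorem hermForm_diagonal (d : ι → ℝ) (u : ι → ℂ) :
    hermForm (diagonal (fun k => (d k : ℂ))) u = ∑ k, d k * ‖u k‖ ^ 2 := by
  simp only [hermForm, mulVec_diagonal, dotProduct, Complex.re_sum]
  refine sum_congr rfl fun k _ => ?_
  simp [← Complex.normSq_eq_norm_sq, Complex.normSq_apply]
  ring

/-- If the quadratic form of `Y ≥ 0` is at most `β` at `Y u`, then `Y` stretches `u` by at most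
`β`. -/
theorem hermForm_one_mulVec_le {Y : Matrix ι ι ℂ} (hY : 0 ≤ Y) {β : ℝ} (hβ : 0 < β)
    {u : ι → ℂ} (h : hermForm Y (Y *ᵥ u) ≤ β * hermForm 1 (Y *ᵥ u)) :
    hermForm 1 (Y *ᵥ u) ≤ β ^ 2 * hermForm 1 u := by
  have hH : Yᴴ = Y := (nonneg_iff_posSemidef.1 hY).isHermitian
  -- As forms at `u`: `(β - Y) Y (β - Y) ≥ 0` and `Y³ ≤ βY²` give `Y² ≤ βY`; then `(β - Y)² ≥ 0`
  -- gives `Y² ≤ β²`.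
  have h1 : 0 ≤ hermForm Y ((β • 1 - Y) *ᵥ u) := hermForm_nonneg hY _
  have h2 : 0 ≤ hermForm 1 ((β • 1 - Y) *ᵥ u) := hermForm_nonneg (nonneg_iff_posSemidef.2 PosSemidef.one) _
  rw [hermForm_mulVec] at h h1 h2
  rw [hermForm_mulVec] at h ⊢
  have e1 : (β • (1 : Matrix ι ι ℂ) - Y)ᴴ * Y * (β • 1 - Y)
      = (β ^ 2) • Y - (2 * β) • (Yᴴ * 1 * Y) + Yᴴ * Y * Y := by
    simp only [conjTranspose_sub, conjTranspose_smul, conjTranspose_one, hH, star_trivial]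
    simp only [sub_mul, mul_sub, smul_mul_assoc, mul_smul_comm, one_mul, mul_one]
    module
  have e2 : (β • (1 : Matrix ι ι ℂ) - Y)ᴴ * 1 * (β • 1 - Y)
      = (β ^ 2) • 1 - (2 * β) • Y + Yᴴ * 1 * Y := by
    simp only [conjTranspose_sub, conjTranspose_smul, conjTranspose_one, hH, star_trivial]
    simp only [sub_mul, mul_sub, smul_mul_assoc, mul_smul_comm, one_mul, mul_one]
    module
  rw [e1, hermForm_add, hermForm_sub, hermForm_smul, hermForm_smul] at h1
  rw [e2, hermForm_add, hermForm_sub, hermForm_smul, hermForm_smul] at h2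
  have h3 : hermForm (Yᴴ * 1 * Y) u ≤ β * hermForm Y u := by
    refine le_of_mul_le_mul_left ?_ hβ
    nlinarith
  nlinarith

end HermForm

/-! ### Min-max and unitary equivalence. -/

section Eigenvalues

open scoped ComplexOrder

variable {ι : Type*} [Fintype ι]

/-- The indices strictly preceding `i` in the decreasing enumeration of eigenvalues used by
`Matrix.IsHermitian.eigenvalues`. -/
noncomputable def precedingIndices (i : ι) : Finset ι :=
  univ.filter fun k =>
    (Fintype.equivOfCardEq (Fintype.card_fin (Fintype.card ι)) : _ ≃ ι).symm k <
      (Fintype.equivOfCardEq (Fintype.card_fin (Fintype.card ι)) : _ ≃ ι).symm i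

theorem self_notMem_precedingIndices (i : ι) : i ∉ precedingIndices i := by
  simp [precedingIndices]

variable [DecidableEq ι]

namespace Matrix.IsHermitian

variable {H : Matrix ι ι ℂ} (hH : H.IsHermitian)

theorem eigenvalues_le_of_mem_preceding {i k : ι} (h : k ∈ insert i (precedingIndices i)) :
    hH.eigenvalues i ≤ hH.eigenvalues k := by
  rcases Finset.mem_insert.1 h with rfl | h
  · exact le_rfl
  · exact hH.eigenvalues₀_antitone (by simpa [precedingIndices] using h : _ < _).le

theorem eigenvalues_le_of_notMem_preceding {i k : ι} (h : k ∉ precedingIndices i) :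
    hH.eigenvalues k ≤ hH.eigenvalues i :=
  hH.eigenvalues₀_antitone (by simpa [precedingIndices] using h)

theorem eq_conj_diagonal :
    H = (hH.eigenvectorUnitary : Matrix ι ι ℂ) *
      diagonal (fun k => (hH.eigenvalues k : ℂ)) * (hH.eigenvectorUnitary : Matrix ι ι ℂ)ᴴ := by
  conv_lhs => rw [hH.spectral_theorem, Unitary.conjStarAlgAut_apply]
  rfl

theorem hermForm_eq_sum (u : ι → ℂ) :
    hermForm H u = ∑ k, hH.eigenvalues k *
      ‖((hH.eigenvectorUnitary : Matrix ι ι ℂ)ᴴ *ᵥ u) k‖ ^ 2 := by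
  rw [← hermForm_diagonal, hermForm_mulVec, conjTranspose_conjTranspose, ← hH.eq_conj_diagonal]

theorem hermForm_one_eq_sum (u : ι → ℂ) :
    hermForm 1 u = ∑ k, ‖((hH.eigenvectorUnitary : Matrix ι ι ℂ)ᴴ *ᵥ u) k‖ ^ 2 := by
  rw [← hermForm_one, hermForm_mulVec, conjTranspose_conjTranspose, mul_one]
  congr 1
  exact (Unitary.coe_mul_star_self hH.eigenvectorUnitary).symm

/-- The coordinates of a vector along the eigenvectors preceding `i`. -/
noncomputable def precedingCoords (i : ι) : (ι → ℂ) →ₗ[ℂ] ({k // k ∈ precedingIndices i} → ℂ) :=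
  LinearMap.funLeft ℂ ℂ Subtype.val ∘ₗ (hH.eigenvectorUnitary : Matrix ι ι ℂ)ᴴ.mulVecLin

theorem precedingCoords_eq_zero_iff {i : ι} {u : ι → ℂ} :
    hH.precedingCoords i u = 0 ↔
      ∀ k ∈ precedingIndices i, ((hH.eigenvectorUnitary : Matrix ι ι ℂ)ᴴ *ᵥ u) k = 0 := by
  simp [precedingCoords, funext_iff, LinearMap.funLeft]

theorem hermForm_le_of_precedingCoords {i : ι} {u : ι → ℂ} (h : hH.precedingCoords i u = 0) :
    hermForm H u ≤ hH.eigenvalues i * hermForm 1 u := by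
  rw [precedingCoords_eq_zero_iff] at h
  rw [hH.hermForm_eq_sum, hH.hermForm_one_eq_sum, mul_sum]
  refine sum_le_sum fun k _ => ?_
  by_cases hk : k ∈ precedingIndices i
  · simp [h k hk]
  · exact mul_le_mul_of_nonneg_right (hH.eigenvalues_le_of_notMem_preceding hk) (sq_nonneg _)

/-- `H` is diagonal in its eigenbasis, so vanishing coordinates stay zero. -/
theorem precedingCoords_mulVec {i : ι} {u : ι → ℂ} (h : hH.precedingCoords i u = 0) :
    hH.precedingCoords i (H *ᵥ u) = 0 := by
  rw [precedingCoords_eq_zero_iff] at h ⊢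
  intro k hk
  have e : (hH.eigenvectorUnitary : Matrix ι ι ℂ)ᴴ * H =
      diagonal (fun k => (hH.eigenvalues k : ℂ)) * (hH.eigenvectorUnitary : Matrix ι ι ℂ)ᴴ := by
    refine (congrArg ((hH.eigenvectorUnitary : Matrix ι ι ℂ)ᴴ * ·) hH.eq_conj_diagonal).trans ?_
    rw [← mul_assoc, ← mul_assoc, show (hH.eigenvectorUnitary : Matrix ι ι ℂ)ᴴ * (hH.eigenvectorUnitary : Matrix ι ι ℂ) = 1
      from Unitary.coe_star_mul_self hH.eigenvectorUnitary, one_mul]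
  rw [mulVec_mulVec, e, ← mulVec_mulVec, mulVec_diagonal, h k hk, mul_zero]

/-- One half of the Courant–Fischer principle. -/
theorem eigenvalues_le_of_forall_ker (i : ι)
    (L : (ι → ℂ) →ₗ[ℂ] ({k // k ∈ precedingIndices i} → ℂ)) {c : ℝ}
    (h : ∀ u, L u = 0 → hermForm H u ≤ c * hermForm 1 u) : hH.eigenvalues i ≤ c := by
  set U := (hH.eigenvectorUnitary : Matrix ι ι ℂ) with hU
  let T := insert i (precedingIndices i)
  let F : ({k // k ∈ T} → ℂ) →ₗ[ℂ] ({k // k ∈ precedingIndices i} → ℂ) :=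
    L ∘ₗ U.mulVecLin ∘ₗ Function.ExtendByZero.linearMap ℂ Subtype.val
  -- Including `i` itself makes the domain one dimension larger than the codomain.
  have hker : LinearMap.ker F ≠ ⊥ := by
    apply LinearMap.ker_ne_bot_of_finrank_lt
    simp only [Module.finrank_fintype_fun_eq_card, Fintype.card_coe, T]
    rw [card_insert_of_notMem (self_notMem_precedingIndices i)]
    exact Nat.lt_succ_self _
  obtain ⟨x, hx, hx0⟩ := Submodule.exists_mem_ne_zero_of_ne_bot hker
  let y : ι → ℂ := Function.extend Subtype.val x 0
  have hLu : L (U *ᵥ y) = 0 := hx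
  have hUy : Uᴴ *ᵥ (U *ᵥ y) = y := by
    rw [mulVec_mulVec, show Uᴴ * U = 1 from Unitary.coe_star_mul_self hH.eigenvectorUnitary,
      one_mulVec]
  have hy : ∀ k, k ∉ T → y k = 0 := by
    intro k hk
    exact Function.extend_apply' _ _ _ (by rintro ⟨a, rfl⟩; exact hk a.2)
  obtain ⟨a, ha⟩ := Function.ne_iff.1 hx0
  have hya : y a = x a := Subtype.val_injective.extend_apply _ _ _
  have hle := h _ hLu
  rw [hH.hermForm_eq_sum, hH.hermForm_one_eq_sum, ← hU, hUy] at hle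
  have hpos : 0 < ∑ k, ‖y k‖ ^ 2 := by
    refine sum_pos' (fun k _ => sq_nonneg _) ⟨a, mem_univ _, ?_⟩
    rw [hya]
    have := norm_pos_iff.2 ha
    positivity
  have hge : hH.eigenvalues i * ∑ k, ‖y k‖ ^ 2 ≤ ∑ k, hH.eigenvalues k * ‖y k‖ ^ 2 := by
    rw [mul_sum]
    refine sum_le_sum fun k _ => ?_
    by_cases hk : k ∈ T
    · exact mul_le_mul_of_nonneg_right (hH.eigenvalues_le_of_mem_preceding hk) (sq_nonneg _)
    · simp [hy k hk]
  exact le_of_mul_le_mul_right (hge.trans hle) hpos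

/-- Eigenvalue domination is Loewner domination up to unitary conjugation. -/
theorem exists_unitary_le {K : Matrix ι ι ℂ} (hK : K.IsHermitian)
    (h : ∀ i, hH.eigenvalues i ≤ hK.eigenvalues i) :
    ∃ V ∈ unitaryGroup ι ℂ, H ≤ V * K * star V := by
  let U : unitaryGroup ι ℂ := hH.eigenvectorUnitary
  let W : unitaryGroup ι ℂ := hK.eigenvectorUnitary
  -- This unitary carries the eigenbasis of `K` to that of `H`, leaving two diagonal matrices to
  -- compare.
  refine ⟨(U * star W : unitaryGroup ι ℂ), (U * star W).2, ?_⟩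
  have e : ((U * star W : unitaryGroup ι ℂ) : Matrix ι ι ℂ) * K *
      star ((U * star W : unitaryGroup ι ℂ) : Matrix ι ι ℂ) =
      (U : Matrix ι ι ℂ) * diagonal (fun k => (hK.eigenvalues k : ℂ)) * (U : Matrix ι ι ℂ)ᴴ := by
    conv_lhs => rw [hK.eq_conj_diagonal]
    have hW : (W : Matrix ι ι ℂ)ᴴ * (W : Matrix ι ι ℂ) = 1 := Unitary.coe_star_mul_self W
    simp only [Submonoid.coe_mul, Unitary.coe_star, star_mul, star_eq_conjTranspose,
      conjTranspose_conjTranspose]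
    change _ * _ * ((W : Matrix ι ι ℂ) * _ * (W : Matrix ι ι ℂ)ᴴ) * _ = _
    simp only [mul_assoc]
    rw [← mul_assoc _ (W : Matrix ι ι ℂ) , hW, one_mul, ← mul_assoc _ (W : Matrix ι ι ℂ), hW,
      one_mul]
  rw [e]
  conv_lhs => rw [hH.eq_conj_diagonal]
  rw [Matrix.le_iff, ← sub_mul, ← mul_sub, diagonal_sub]
  refine PosSemidef.mul_mul_conjTranspose_same (PosSemidef.diagonal fun k => ?_) _
  simpa [Complex.le_def] using h k

end Matrix.IsHermitian

/-- `|Z|` and `|Zᴴ|` are unitarily equivalent. -/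
theorem exists_unitary_abs_eq_conj_abs_star (Z : Matrix ι ι ℂ) :
    ∃ W ∈ unitaryGroup ι ℂ, CFC.abs Z = W * CFC.abs (star Z) * star W := by
  have h1 : (star Z * Z).IsHermitian := IsSelfAdjoint.star_mul_self Z
  have h2 : (star (star Z) * star Z).IsHermitian := IsSelfAdjoint.star_mul_self (star Z)
  have he : h1.eigenvalues = h2.eigenvalues := by
    rw [IsHermitian.eigenvalues_eq_eigenvalues_iff, star_star, charpoly_mul_comm]
  let U : unitaryGroup ι ℂ := h1.eigenvectorUnitary
  let W : unitaryGroup ι ℂ := h2.eigenvectorUnitary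
  have hX : star Z * Z = ((U * star W : unitaryGroup ι ℂ) : Matrix ι ι ℂ) *
      (star (star Z) * star Z) * star ((U * star W : unitaryGroup ι ℂ) : Matrix ι ι ℂ) := by
    have hW : (W : Matrix ι ι ℂ)ᴴ * (W : Matrix ι ι ℂ) = 1 := Unitary.coe_star_mul_self W
    rw [h1.eq_conj_diagonal, h2.eq_conj_diagonal, he]
    change (U : Matrix ι ι ℂ) * _ * (U : Matrix ι ι ℂ)ᴴ = _ *
      ((W : Matrix ι ι ℂ) * _ * (W : Matrix ι ι ℂ)ᴴ) * _
    simp only [Submonoid.coe_mul, Unitary.coe_star, star_mul, star_eq_conjTranspose,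
      conjTranspose_conjTranspose]
    simp only [mul_assoc]
    rw [← mul_assoc _ (W : Matrix ι ι ℂ), hW, one_mul, ← mul_assoc _ (W : Matrix ι ι ℂ), hW,
      one_mul]
  set V : unitaryGroup ι ℂ := U * star W
  refine ⟨V, V.2, ?_⟩
  have hV : star (V : Matrix ι ι ℂ) * (V : Matrix ι ι ℂ) = 1 := Unitary.coe_star_mul_self V
  rw [CFC.abs]
  refine CFC.sqrt_unique ?_ (star_right_conjugate_nonneg (CFC.abs_nonneg _) _)
  rw [hX, ← CFC.abs_mul_abs (star Z)]
  simp only [mul_assoc]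
  rw [← mul_assoc (star (V : Matrix ι ι ℂ)) (V : Matrix ι ι ℂ), hV, one_mul]

end Eigenvalues

/-! ### Moments of the Bernstein polynomials. -/

section Bernstein

variable {R : Type*} [Ring R] [Algebra ℝ R]

theorem sum_aeval_bernstein (X : R) (m : ℕ) :
    ∑ k ∈ range (m + 1), Polynomial.aeval X (bernsteinPolynomial ℝ m k) = 1 := by
  rw [← map_sum, bernsteinPolynomial.sum, map_one]

theorem sum_smul_aeval_bernstein (X : R) (m : ℕ) :
    ∑ k ∈ range (m + 1), (k : ℝ) • Polynomial.aeval X (bernsteinPolynomial ℝ m k)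
      = (m : ℝ) • X := by
  have h := congrArg (Polynomial.aeval X) (bernsteinPolynomial.sum_smul ℝ m)
  simpa [map_sum, map_nsmul, Nat.cast_smul_eq_nsmul] using h

theorem sum_sq_smul_aeval_bernstein (X : R) (m : ℕ) :
    ∑ k ∈ range (m + 1), ((k : ℝ) ^ 2) • Polynomial.aeval X (bernsteinPolynomial ℝ m k)
      = ((m : ℝ) * (m - 1)) • (X * X) + (m : ℝ) • X := by
  have h := congrArg (Polynomial.aeval X) (bernsteinPolynomial.sum_mul_smul ℝ m)
  -- Truncated subtraction is harmless: at `k = 0` the factor `k` vanishes.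
  have hc : ∀ k : ℕ, ((k * (k - 1) : ℕ) : ℝ) = (k : ℝ) * (k - 1) := by
    rintro (_ | k) <;> simp
  simp only [map_sum, ← Nat.cast_smul_eq_nsmul ℝ, hc] at h
  simp only [map_smul, map_pow, Polynomial.aeval_X, pow_two X] at h
  rw [← h, ← sum_smul_aeval_bernstein, ← sum_add_distrib]
  refine sum_congr rfl fun k _ => ?_
  rw [← add_smul]
  congr 1
  ring

end Bernstein

/-! ### Kadison's inequality by Bernstein approximation. -/

section Kadison

variable {𝒜 : Type*} [CStarAlgebra 𝒜] [PartialOrder 𝒜] [StarOrderedRing 𝒜]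

/-- A discrete operator Cauchy–Schwarz inequality for a finite sub-resolution of the identity. -/
theorem sum_smul_mul_self_le {M : Type*} [Ring M] [StarRing M] [PartialOrder M] [StarOrderedRing M]
    [Algebra ℝ M] [StarModule ℝ M] {κ : Type*} (s : Finset κ) (t : κ → ℝ) (P : κ → M)
    (hP : ∀ k ∈ s, 0 ≤ P k) (hs : ∑ k ∈ s, P k ≤ 1) :
    (∑ k ∈ s, t k • P k) * (∑ k ∈ s, t k • P k) ≤ ∑ k ∈ s, (t k ^ 2) • P k := by
  set Y := ∑ k ∈ s, t k • P k with hY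
  have hYs : star Y = Y := by
    rw [hY, star_sum]
    refine sum_congr rfl fun k hk => ?_
    rw [star_smul, (IsSelfAdjoint.of_nonneg (hP k hk)).star_eq, star_trivial]
  -- A variance: it expands to `∑ t²P - 2Y² + Y(∑ P)Y`, whose last term is at most `Y²`.
  have h1 : 0 ≤ ∑ k ∈ s, star (t k • 1 - Y) * P k * (t k • 1 - Y) :=
    sum_nonneg fun k hk => star_left_conjugate_nonneg (hP k hk) _
  have h2 : ∑ k ∈ s, star (t k • 1 - Y) * P k * (t k • 1 - Y) =
      ∑ k ∈ s, (t k ^ 2) • P k - Y * Y - Y * Y + Y * (∑ k ∈ s, P k) * Y := by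
    have e : ∀ k ∈ s, star (t k • 1 - Y) * P k * (t k • 1 - Y) =
        (t k ^ 2) • P k - (t k • P k) * Y - Y * (t k • P k) + Y * P k * Y := by
      intro k _
      rw [star_sub, star_smul, star_one, star_trivial, hYs]
      simp only [sub_mul, mul_sub, smul_mul_assoc, mul_smul_comm, one_mul, mul_one]
      module
    rw [sum_congr rfl e, sum_add_distrib, sum_sub_distrib, sum_sub_distrib, ← sum_mul, ← mul_sum,
      ← sum_mul, ← mul_sum, ← hY]
  have h3 : Y * (∑ k ∈ s, P k) * Y ≤ Y * Y := by
    simpa [hYs] using star_left_conjugate_le_conjugate hs Y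
  rw [h2] at h1
  have h4 := h1.trans (add_le_add_right h3 _)
  rw [sub_add_cancel] at h4
  exact sub_nonneg.1 h4

theorem aeval_bernstein_nonneg {X : 𝒜} (h0 : 0 ≤ X) (h1 : X ≤ 1) (m k : ℕ) :
    0 ≤ Polynomial.aeval X (bernsteinPolynomial ℝ m k) := by
  have hs : IsSelfAdjoint X := .of_nonneg h0
  rw [← cfc_polynomial (R := ℝ) _ X]
  refine cfc_nonneg fun x hx => ?_
  have hx0 : 0 ≤ x := spectrum_nonneg_of_nonneg h0 hx
  have hx1 : x ≤ 1 := by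
    have := (le_algebraMap_iff_spectrum_le (A := 𝒜) (r := (1 : ℝ)) (a := X)).1 (by simpa using h1)
    exact this x hx
  simp only [bernsteinPolynomial, Polynomial.eval_mul, Polynomial.eval_natCast,
    Polynomial.eval_pow, Polynomial.eval_X, Polynomial.eval_sub, Polynomial.eval_one]
  have : 0 ≤ 1 - x := by linarith
  positivity

variable {ι : Type*} [Fintype ι] [DecidableEq ι] (Φ : 𝒜 →ₚ[ℂ] Matrix ι ι ℂ)

/-- The Bernstein polynomials at `X` are positive with sum `1`, a discrete substitute for the
spectral measure. Cauchy–Schwarz for their images, with weights `k`, is Kadison's inequality up to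
an error of order `1/m`. -/
theorem bernstein_kadison (hΦ : Φ 1 ≤ 1) {X : 𝒜} (h0 : 0 ≤ X) (h1 : X ≤ 1) (m : ℕ) :
    ((m : ℝ) ^ 2) • (Φ X * Φ X) ≤ ((m : ℝ) * (m - 1)) • Φ (X * X) + (m : ℝ) • Φ X := by
  have h := sum_smul_mul_self_le (range (m + 1)) (fun k => (k : ℝ))
    (fun k => Φ (Polynomial.aeval X (bernsteinPolynomial ℝ m k)))
    (fun k _ => map_nonneg Φ (aeval_bernstein_nonneg h0 h1 m k))
    (by rw [← map_sum, sum_aeval_bernstein]; exact hΦ)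
  simp only [← Φ.map_smul_of_tower, ← map_sum, sum_smul_aeval_bernstein,
    sum_sq_smul_aeval_bernstein] at h
  simpa only [map_add, Φ.map_smul_of_tower, smul_mul_smul_comm, ← pow_two (m : ℝ)] using h

/-- Kadison's inequality, at the level of quadratic forms. -/
theorem hermForm_map_mul_map_le (hΦ : Φ 1 ≤ 1) {X : 𝒜} (hX : 0 ≤ X) (u : ι → ℂ) :
    hermForm (Φ X * Φ X) u ≤ hermForm (Φ (X * X)) u := by
  have key : ∀ {X : 𝒜}, 0 ≤ X → X ≤ 1 →
      hermForm (Φ X * Φ X) u ≤ hermForm (Φ (X * X)) u := by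
    intro X h0 h1
    by_contra! hlt
    obtain ⟨m, hm⟩ := exists_nat_gt (|hermForm (Φ X) u - hermForm (Φ (X * X)) u| /
      (hermForm (Φ X * Φ X) u - hermForm (Φ (X * X)) u))
    have hd := sub_pos.2 hlt
    have hm0 : (0 : ℝ) < m := lt_of_le_of_lt (by positivity) hm
    rw [div_lt_iff₀ hd] at hm
    have h := hermForm_mono (bernstein_kadison Φ hΦ h0 h1 m) u
    rw [hermForm_add, hermForm_smul, hermForm_smul, hermForm_smul] at h
    have h' : (m : ℝ) * (m * hermForm (Φ X * Φ X) u) ≤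
        m * ((m - 1) * hermForm (Φ (X * X)) u + hermForm (Φ X) u) := by linarith
    have h2 := le_of_mul_le_mul_left h' hm0
    have h3 := le_abs_self (hermForm (Φ X) u - hermForm (Φ (X * X)) u)
    linarith
  -- Both sides scale quadratically; the `+ 1` covers `X = 0`.
  have hM : 0 < ‖X‖ + 1 := by positivity
  have h := key (X := (‖X‖ + 1)⁻¹ • X) (smul_nonneg (inv_nonneg.2 hM.le) hX) (by
    rw [← CStarAlgebra.norm_le_one_iff_of_nonneg _ (smul_nonneg (inv_nonneg.2 hM.le) hX),
      norm_smul, norm_inv, Real.norm_of_nonneg hM.le, inv_mul_le_iff₀ hM]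
    linarith)
  simp only [smul_mul_smul_comm, Φ.map_smul_of_tower, hermForm_smul] at h
  exact le_of_mul_le_mul_left h (by positivity)

end Kadison

/-! ### Powers, Jensen's inequality and the eigenvalue estimate. -/

section Powers

open scoped ComplexOrder

variable {𝒜 : Type*} [CStarAlgebra 𝒜] [PartialOrder 𝒜] [StarOrderedRing 𝒜]

theorem CFC.rpow_add_of_nonneg_exponents {A : 𝒜} (hA : 0 ≤ A) {s t : ℝ} (hs : 0 ≤ s) (ht : 0 ≤ t) :
    A ^ s * A ^ t = A ^ (s + t) := by
  rw [CFC.rpow_eq_cfc_real hA, CFC.rpow_eq_cfc_real hA, CFC.rpow_eq_cfc_real hA,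
    ← cfc_mul _ _ A (Real.continuous_rpow_const hs).continuousOn
      (Real.continuous_rpow_const ht).continuousOn]
  refine cfc_congr fun x hx => ?_
  exact (Real.rpow_add_of_nonneg (spectrum_nonneg_of_nonneg hA hx) hs ht).symm

/-- The operator form of Young's inequality for powers of one element. -/
theorem CFC.smul_rpow_le_young {A : 𝒜} (hA : 0 ≤ A) {s θ c : ℝ} (hs : 0 ≤ s) (hθ : 0 ≤ θ)
    (hθ1 : θ ≤ 1) (hc : 0 ≤ c) :
    (c ^ (1 - θ)) • A ^ (θ * s) ≤ θ • A ^ s + ((1 - θ) * c) • (1 : 𝒜) := by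
  have hcs := Real.continuous_rpow_const hs
  have hcθ := Real.continuous_rpow_const (mul_nonneg hθ hs)
  rw [CFC.rpow_eq_cfc_real hA, CFC.rpow_eq_cfc_real hA, ← cfc_smul _ _ A hcθ.continuousOn,
    ← cfc_smul _ _ A hcs.continuousOn, ← Algebra.algebraMap_eq_smul_one,
    ← cfc_add_const (R := ℝ) _ (fun x => θ • x ^ s) A (hf := (hcs.const_smul θ).continuousOn)]
  refine cfc_mono (fun x hx => ?_) (hcθ.const_smul (c ^ (1 - θ))).continuousOn
    ((hcs.const_smul θ).add continuous_const).continuousOn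
  have hx0 : 0 ≤ x := spectrum_nonneg_of_nonneg hA hx
  have := Real.geom_mean_le_arith_mean2_weighted hθ (sub_nonneg.2 hθ1) (Real.rpow_nonneg hx0 s) hc
    (by ring)
  rw [← Real.rpow_mul hx0, mul_comm s θ] at this
  simpa [mul_comm] using this

variable {ι : Type*} [Fintype ι] [DecidableEq ι] (Φ : 𝒜 →ₚ[ℂ] Matrix ι ι ℂ)

/-- Jensen's inequality for fractional powers, at a fixed vector. -/
theorem hermForm_map_rpow_le (hΦ : Φ 1 ≤ 1) {A : 𝒜} (hA : 0 ≤ A) {s θ β : ℝ} (hs : 0 ≤ s)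
    (hθ : 0 ≤ θ) (hθ1 : θ ≤ 1) (hβ : 0 < β) {u : ι → ℂ}
    (h : hermForm (Φ (A ^ s)) u ≤ β * hermForm 1 u) :
    hermForm (Φ (A ^ (θ * s))) u ≤ β ^ θ * hermForm 1 u := by
  -- With `c = β`, Young's right side is at most `θβ + (1 - θ)β = β` times `‖u‖²`.
  have h1 := hermForm_mono (OrderHomClass.mono Φ
    (CFC.smul_rpow_le_young hA hs hθ hθ1 hβ.le)) u
  simp only [map_add, Φ.map_smul_of_tower, hermForm_add, hermForm_smul] at h1
  have h2 := mul_le_mul_of_nonneg_left (hermForm_mono hΦ u)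
    (mul_nonneg (sub_nonneg.2 hθ1) hβ.le)
  have h3 := mul_le_mul_of_nonneg_left h hθ
  refine le_of_mul_le_mul_left (a := β ^ (1 - θ)) ?_ (Real.rpow_pos_of_pos hβ _)
  rw [← mul_assoc, ← Real.rpow_add hβ, sub_add_cancel, Real.rpow_one]
  linarith

theorem eigenvalues_abs_mul_mul_le (hΦ : Φ 1 ≤ 1) {A : 𝒜} (hA : 0 ≤ A) {q x y : ℝ} (hq : 0 ≤ q)
    (hx : 0 ≤ x) (hx1 : 2 * x ≤ 1) (hy : 0 ≤ y) (hy1 : y ≤ 1)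
    (hZ : (CFC.abs (Φ (A ^ (x * q)) * Φ (A ^ q) * Φ (A ^ (y * q)))).IsHermitian)
    (hC : (Φ (A ^ (x * q + q + y * q))).IsHermitian) (i : ι) :
    hZ.eigenvalues i ≤ hC.eigenvalues i := by
  have hΦA : ∀ s : ℝ, 0 ≤ Φ (A ^ s) := fun s => map_nonneg Φ CFC.rpow_nonneg
  have hB : (Φ (A ^ q)).IsHermitian := (nonneg_iff_posSemidef.1 (hΦA q)).isHermitian
  have hk : 0 < x + 1 + y := by positivity
  have hν0 : 0 ≤ hC.eigenvalues i := (nonneg_iff_posSemidef.1 (hΦA _)).eigenvalues_nonneg i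
  -- The eigenvalue may be `0`, whereas Jensen's inequality needs a positive bound.
  refine le_of_forall_gt_imp_ge_of_dense fun ν hν => ?_
  have hνp : 0 < ν := hν0.trans_lt hν
  set β := ν ^ (x + 1 + y)⁻¹ with hβdef
  have hβ : 0 < β := Real.rpow_pos_of_pos hνp _
  have hN : ∀ u : ι → ℂ, 0 ≤ hermForm 1 u := fun u =>
    hermForm_nonneg (nonneg_iff_posSemidef.2 PosSemidef.one) u
  have hBβ : hB.eigenvalues i ≤ β := by
    refine hB.eigenvalues_le_of_forall_ker i (hC.precedingCoords i) fun u hu => ?_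
    have h := (hC.hermForm_le_of_precedingCoords hu).trans
      (mul_le_mul_of_nonneg_right hν.le (hN u))
    have h' := hermForm_map_rpow_le Φ hΦ hA (θ := (x + 1 + y)⁻¹) (by positivity)
      (by positivity) (inv_le_one_of_one_le₀ (by linarith)) hνp h
    rwa [show (x + 1 + y)⁻¹ * (x * q + q + y * q) = q by field_simp] at h'
  have hG : ∀ u, hB.precedingCoords i u = 0 → hermForm (Φ (A ^ q)) u ≤ β * hermForm 1 u :=
    fun u hu => (hB.hermForm_le_of_precedingCoords hu).trans
      (mul_le_mul_of_nonneg_right hBβ (hN u))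
  refine hZ.eigenvalues_le_of_forall_ker i
    (hB.precedingCoords i ∘ₗ (Φ (A ^ (y * q))).mulVecLin) fun u hu => ?_
  set Z := Φ (A ^ (x * q)) * Φ (A ^ q) * Φ (A ^ (y * q)) with hZdef
  set g := Φ (A ^ (y * q)) *ᵥ u
  have hg : hB.precedingCoords i g = 0 := hu
  set w := Φ (A ^ q) *ᵥ g
  have hw : hB.precedingCoords i w = 0 := hB.precedingCoords_mulVec hg
  have b1 : hermForm 1 g ≤ (β ^ y) ^ 2 * hermForm 1 u :=
    hermForm_one_mulVec_le (hΦA _) (Real.rpow_pos_of_pos hβ _)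
      (hermForm_map_rpow_le Φ hΦ hA hq hy hy1 hβ (hG g hg))
  have b2 : hermForm 1 w ≤ β ^ 2 * hermForm 1 g :=
    hermForm_one_mulVec_le (hΦA _) hβ (hG w hw)
  have b3 : hermForm 1 (Φ (A ^ (x * q)) *ᵥ w) ≤ (β ^ x) ^ 2 * hermForm 1 w := by
    rw [hermForm_mulVec, (nonneg_iff_posSemidef.1 (hΦA _)).isHermitian, mul_one]
    -- The output of this factor need not stay in the invariant subspace, so the exponent is doubled
    -- and Jensen's inequality is applied at `w` itself.
    refine (hermForm_map_mul_map_le Φ hΦ CFC.rpow_nonneg w).trans ?_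
    have h := hermForm_map_rpow_le Φ hΦ hA hq (by positivity) hx1 hβ (hG w hw)
    rwa [show 2 * x * q = x * q + x * q by ring,
      ← CFC.rpow_add_of_nonneg_exponents hA (by positivity) (by positivity),
      show 2 * x = x * 2 by ring, Real.rpow_mul hβ.le, Real.rpow_two] at h
  have hν2 : (β ^ x) ^ 2 * (β ^ 2 * ((β ^ y) ^ 2 * hermForm 1 u)) = ν ^ 2 * hermForm 1 u := by
    have : β ^ x * β * β ^ y = ν := by
      nth_rewrite 2 [← Real.rpow_one β]
      rw [← Real.rpow_add hβ, ← Real.rpow_add hβ, hβdef, ← Real.rpow_mul hνp.le,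
        inv_mul_cancel₀ hk.ne', Real.rpow_one]
    rw [← this]
    ring
  have b : hermForm 1 (Z *ᵥ u) ≤ ν ^ 2 * hermForm 1 u := by
    have e : Z *ᵥ u = Φ (A ^ (x * q)) *ᵥ w := by
      simp only [hZdef, w, g, mulVec_mulVec, Matrix.mul_assoc]
    rw [e, ← hν2]
    exact b3.trans (mul_le_mul_of_nonneg_left
      (b2.trans (mul_le_mul_of_nonneg_left b1 (by positivity))) (by positivity))
  rw [hermForm_mulVec, mul_one, ← star_eq_conjTranspose, ← CFC.abs_mul_abs] at b
  -- From `2ν|Z| ≤ |Z|² + ν²`, the bound on `|Z|²` at `u` becomes one on `|Z|`.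
  have h0 : 0 ≤ hermForm 1 ((CFC.abs Z - ν • 1) *ᵥ u) := hN _
  have e : (CFC.abs Z - ν • (1 : Matrix ι ι ℂ))ᴴ * 1 * (CFC.abs Z - ν • 1)
      = CFC.abs Z * CFC.abs Z - (2 * ν) • CFC.abs Z + (ν ^ 2) • 1 := by
    simp only [conjTranspose_sub, conjTranspose_smul, conjTranspose_one, hZ.eq, star_trivial]
    simp only [sub_mul, mul_sub, smul_mul_assoc, mul_smul_comm, one_mul, mul_one]
    module
  rw [hermForm_mulVec, e, hermForm_add, hermForm_sub, hermForm_smul, hermForm_smul] at h0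
  refine le_of_mul_le_mul_left ?_ hνp
  nlinarith

theorem exists_unitary_abs_le_of_le_half (hΦ : Φ 1 ≤ 1) {A : 𝒜} (hA : 0 ≤ A) {p q r : ℝ}
    (hp : 0 ≤ p) (hr : 0 ≤ r) (hpq : p ≤ q / 2) (hrq : r ≤ q) :
    ∃ V ∈ unitaryGroup ι ℂ,
      CFC.abs (Φ (A ^ p) * Φ (A ^ q) * Φ (A ^ r)) ≤ V * Φ (A ^ (p + q + r)) * star V := by
  have hq : 0 ≤ q := hr.trans hrq
  obtain ⟨x, hx, hx1, rfl⟩ : ∃ x, 0 ≤ x ∧ 2 * x ≤ 1 ∧ p = x * q := by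
    -- If `q = 0`, then `p = 0` and any admissible ratio works.
    rcases hq.eq_or_lt with rfl | h
    · exact ⟨0, le_rfl, by norm_num, by linarith⟩
    · refine ⟨p / q, by positivity, ?_, by field_simp⟩
      rw [← mul_div_assoc, div_le_one h]
      linarith
  obtain ⟨y, hy, hy1, rfl⟩ : ∃ y, 0 ≤ y ∧ y ≤ 1 ∧ r = y * q := by
    rcases hq.eq_or_lt with rfl | h
    · exact ⟨0, le_rfl, by norm_num, by linarith⟩
    · exact ⟨r / q, by positivity, (div_le_one h).2 hrq, by field_simp⟩
  have hZ := (nonneg_iff_posSemidef.1 (CFC.abs_nonneg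
    (Φ (A ^ (x * q)) * Φ (A ^ q) * Φ (A ^ (y * q))))).isHermitian
  have hC := (nonneg_iff_posSemidef.1 (map_nonneg Φ
    (CFC.rpow_nonneg : 0 ≤ A ^ (x * q + q + y * q)))).isHermitian
  exact hZ.exists_unitary_le hC (eigenvalues_abs_mul_mul_le Φ hΦ hA hq hx hx1 hy hy1 hZ hC)

end Powers

theorem proposition1p3 {𝒜 : Type*} [CStarAlgebra 𝒜] [PartialOrder 𝒜] [StarOrderedRing 𝒜]
    {n : ℕ} (Φ : 𝒜 →ₚ[ℂ] Matrix (Fin n) (Fin n) ℂ) (hΦ : Φ 1 ≤ 1)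
    (A : 𝒜) (hA : 0 ≤ A) (p q r : ℝ) (hp : 0 ≤ p) (hq : 0 ≤ q) (hr : 0 ≤ r)
    (hmin : min p r ≤ q / 2) (hmax : max p r ≤ q) :
    ∃ V ∈ Matrix.unitaryGroup (Fin n) ℂ,
      CFC.abs (Φ (A ^ p) * Φ (A ^ q) * Φ (A ^ r)) ≤ V * Φ (A ^ (p + q + r)) * star V := by
  obtain ⟨hpq, hrq⟩ := max_le_iff.1 hmax
  rcases min_le_iff.1 hmin with h | h
  · exact exists_unitary_abs_le_of_le_half Φ hΦ hA hp hr h hrq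
  -- The adjoint of the product swaps `p` and `r`, and its modulus is unitarily equivalent to the
  -- original one.
  · obtain ⟨V, hV, hle⟩ := exists_unitary_abs_le_of_le_half Φ hΦ hA hr hp h hpq
    obtain ⟨W, hW, hWe⟩ := exists_unitary_abs_eq_conj_abs_star (Φ (A ^ p) * Φ (A ^ q) * Φ (A ^ r))
    have hs : ∀ s : ℝ, star (Φ (A ^ s)) = Φ (A ^ s) := fun s =>
      (IsSelfAdjoint.of_nonneg (map_nonneg Φ CFC.rpow_nonneg)).star_eq
    refine ⟨W * V, mul_mem hW hV, ?_⟩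
    rw [hWe, star_mul, star_mul, hs, hs, hs, ← mul_assoc (Φ (A ^ r))]
    have h2 := star_right_conjugate_le_conjugate hle W
    rw [show p + q + r = r + q + p by ring, star_mul]
    simpa only [mul_assoc] using h2
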